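/- Let $N\ge 1$, let $\Omega\subset\mathbb{R}^N$ be a bounded, connected, nonempty open set of class $C^2$ with outer unit normal vector $n$ on $\partial\Omega$, and let $d_1,d_2,d_3,d_4\in(0,+\infty)$. Let $u_1,u_2,u_3,u_4\in C^2(\overline{\Omega})$ be nonnegative real-valued functions such that, for every $1\le i\le 4$, $$-d_i\,\Delta u_i=(-1)^i\,(u_1u_3-u_2u_4)\ \text{ in }\Omega,\qquad \frac{\partial u_i}{\partial n}=0\ \text{ on }\partial\Omega .$$ Then, for every $1\le i\le 4$, the function $u_i$ is constant on $\overline{\Omega}$. -/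

import Mathlib

open Filter Topology
open scoped RealInnerProductSpace Gradient

/-- An open set `Ω` is of class `C^2`: near every boundary point there is a direction `e` such that
`Ω` is the strict subgraph, in the direction `e`, of a `C^2` function `γ` of the variables
orthogonal to `e` (here `x - ⟪x, e⟫ • e` is the orthogonal projection of `x` on the hyperplane
orthogonal to `e`; only the values of `γ` on this hyperplane matter). -/
def IsC2Domain {N : ℕ} (Ω : Set (EuclideanSpace ℝ (Fin N))) : Prop :=
  IsOpen Ω ∧ ∀ x₀ ∈ frontier Ω, ∃ e : EuclideanSpace ℝ (Fin N), ‖e‖ = 1 ∧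
    ∃ γ : EuclideanSpace ℝ (Fin N) → ℝ, ContDiff ℝ 2 γ ∧
      ∃ r > 0, ∀ x ∈ Metric.ball x₀ r, x ∈ Ω ↔ ⟪x, e⟫ < γ (x - ⟪x, e⟫ • e)

/-- `ν` is the outer unit normal vector to `∂Ω` at `x`: it is the normalized gradient at `x` of a
local `C^1` defining function `ρ` of `Ω`, that is, one with `Ω = {ρ < 0}` near `x`, `ρ x = 0` and
`∇ ρ x ≠ 0`. -/
def IsOuterUnitNormal {N : ℕ} (Ω : Set (EuclideanSpace ℝ (Fin N)))
    (x ν : EuclideanSpace ℝ (Fin N)) : Prop :=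
  ∃ ρ : EuclideanSpace ℝ (Fin N) → ℝ, ContDiffAt ℝ 1 ρ x ∧ (∀ᶠ y in 𝓝 x, y ∈ Ω ↔ ρ y < 0) ∧
    ρ x = 0 ∧ ∇ ρ x ≠ 0 ∧ ν = ‖∇ ρ x‖⁻¹ • ∇ ρ x

/-- The homogeneous Neumann condition `∂u/∂n = 0` on `∂Ω`, for a function `u` that is `C^1` on the
closure of `Ω`. The derivative at a boundary point is taken within the closure of `Ω`, so that
values of `u` outside the closure play no role. -/
def NeumannCondition {N : ℕ} (Ω : Set (EuclideanSpace ℝ (Fin N)))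
    (u : EuclideanSpace ℝ (Fin N) → ℝ) : Prop :=
  ∀ x ∈ frontier Ω, ∀ ν, IsOuterUnitNormal Ω x ν → fderivWithin ℝ u (closure Ω) x ν = 0

/-!
The proof combines the maximum principle with three conservation laws.

Adding or subtracting the equations, `d 0 • u 0 + d 1 • u 1`,
`d 0 • u 0 - d 2 • u 2` and `d 0 • u 0 + d 3 • u 3` are harmonic with homogeneous Neumann
condition, hence constant (`exists_linearCombination_eq_const`). So `u 2` is a nondecreasing and
`u 1`, `u 3` are nonincreasing affine functions of `u 0`. As all components are nonnegative, the
reaction term `w = u 0 * u 2 - u 1 * u 3`, which equals `d 0 * Δ (u 0)`, is a nondecreasing function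
of `u 0`. If `w` is positive somewhere, it is positive near every maximum point of `u 0`, so `u 0` is
subharmonic there; otherwise `w ≤ 0` and `-u 0` is subharmonic in `Ω`. In both cases
`exists_eq_const_of_neumann` shows that `u 0`, and with it every component, is constant.

`exists_eq_const_of_neumann` is a strong maximum principle under the Neumann condition, which asks
for subharmonicity only near the maximum points. Both of its ingredients, the openness of the set of
interior maximum points and the exclusion of a maximum attained on the boundary only, come from Hopf's
boundary point lemma on a ball (`hopf_boundary_point`), proved with the barrier
`exp (-α * ‖z - y‖ ^ 2)`. At the boundary it applies because a `C^2` domain satisfies an interior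
ball condition (`IsC2Domain.exists_closedBall`).
-/

/-! ### The Laplacian at a maximum and Hopf's lemma on a ball -/

section MaximumPrinciple

variable {E : Type*} [NormedAddCommGroup E] [InnerProductSpace ℝ E]

theorem ContDiffAt.deriv_deriv_comp_add_smul {f : E → ℝ} {x : E} (hf : ContDiffAt ℝ 2 f x)
    (e : E) :
    deriv (deriv fun t : ℝ => f (x + t • e)) 0 = iteratedFDeriv ℝ 2 f x ![e, e] := by
  have hline : ∀ t : ℝ, HasDerivAt (fun t : ℝ => x + t • e) e t := fun t => by
    simpa using ((hasDerivAt_id t).smul_const e).const_add x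
  have htend : Tendsto (fun t : ℝ => x + t • e) (𝓝 0) (𝓝 x) := by
    simpa using (hline 0).continuousAt.tendsto
  have h1 : deriv (fun t : ℝ => f (x + t • e)) =ᶠ[𝓝 0] fun t => fderiv ℝ f (x + t • e) e := by
    filter_upwards [htend.eventually (hf.eventually (by simp))] with t ht
    exact ((ht.differentiableAt (by simp)).hasFDerivAt.comp_hasDerivAt t (hline t)).deriv
  have h2 : HasFDerivAt (fderiv ℝ f) (fderiv ℝ (fderiv ℝ f) x) (x + (0 : ℝ) • e) := by
    simpa using ((hf.fderiv_right (m := 1) (by norm_num)).differentiableAt (by simp)).hasFDerivAt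
  have h3 : HasDerivAt (fun t : ℝ => fderiv ℝ f (x + t • e)) (fderiv ℝ (fderiv ℝ f) x e) 0 :=
    h2.comp_hasDerivAt 0 (hline 0)
  have h4 : HasDerivAt (fun t : ℝ => fderiv ℝ f (x + t • e) e)
      (fderiv ℝ (fderiv ℝ f) x e e) 0 := by
    simpa using h3.clm_apply (hasDerivAt_const (0 : ℝ) e)
  rw [h1.deriv_eq, iteratedFDeriv_two_apply, h4.deriv]
  rfl

theorem IsLocalMax.iteratedFDeriv_two_nonpos {f : E → ℝ} {x : E} (h : IsLocalMax f x)
    (hf : ContDiffAt ℝ 2 f x) (e : E) : iteratedFDeriv ℝ 2 f x ![e, e] ≤ 0 := by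
  rw [← hf.deriv_deriv_comp_add_smul]
  by_contra! hpos
  have hcont : ContinuousAt (fun t : ℝ => x + t • e) 0 := by fun_prop
  have hx : x + (0 : ℝ) • e = x := by simp
  have hmax : IsLocalMax (fun t : ℝ => f (x + t • e)) 0 := by
    have h' : ∀ᶠ z in 𝓝 (x + (0 : ℝ) • e), f z ≤ f (x + (0 : ℝ) • e) := by rwa [hx]
    exact hcont.eventually h'
  have hfc : ContinuousAt (fun t : ℝ => f (x + t • e)) 0 :=
    ContinuousAt.comp (g := f) (by simpa using hf.continuousAt) hcont
  have hmin := isLocalMin_of_deriv_deriv_pos hpos hmax.deriv_eq_zero hfc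
  -- A local maximum that is also a local minimum is locally constant along the line.
  have hconst : (fun t : ℝ => f (x + t • e)) =ᶠ[𝓝 0] fun _ => f (x + (0 : ℝ) • e) := by
    filter_upwards [hmax, hmin] with t h1 h2 using le_antisymm h1 h2
  rw [hconst.deriv.deriv_eq] at hpos
  simp at hpos

theorem hasFDerivAt_exp_neg_mul_norm_sub_sq (α : ℝ) (y x : E) :
    HasFDerivAt (fun z => Real.exp (-α * ‖z - y‖ ^ 2))
      (Real.exp (-α * ‖x - y‖ ^ 2) • ((-α) • (2 • innerSL ℝ (x - y)))) x := by
  have h : HasFDerivAt (fun z : E => ‖z - y‖ ^ 2) (2 • innerSL ℝ (x - y)) x := by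
    simpa using ((hasFDerivAt_id x).sub_const y).norm_sq
  exact (h.const_mul (-α)).exp

theorem contDiff_exp_neg_mul_norm_sub_sq (α : ℝ) (y : E) :
    ContDiff ℝ 2 (fun z => Real.exp (-α * ‖z - y‖ ^ 2)) :=
  (contDiff_const.mul ((contDiff_id.sub contDiff_const).norm_sq ℝ)).exp

variable [FiniteDimensional ℝ E]

theorem IsLocalMax.laplacian_nonpos {f : E → ℝ} {x : E} (h : IsLocalMax f x)
    (hf : ContDiffAt ℝ 2 f x) : Laplacian.laplacian f x ≤ 0 := by
  rw [InnerProductSpace.laplacian_eq_iteratedFDeriv_stdOrthonormalBasis]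
  exact Finset.sum_nonpos fun i _ => h.iteratedFDeriv_two_nonpos hf _

theorem laplacian_exp_neg_mul_norm_sub_sq (α : ℝ) (y x : E) :
    Laplacian.laplacian (fun z => Real.exp (-α * ‖z - y‖ ^ 2)) x =
      Real.exp (-α * ‖x - y‖ ^ 2) *
        (4 * α ^ 2 * ‖x - y‖ ^ 2 - 2 * α * Module.finrank ℝ E) := by
  have key : ∀ e : E, ‖e‖ = 1 →
      iteratedFDeriv ℝ 2 (fun z => Real.exp (-α * ‖z - y‖ ^ 2)) x ![e, e] =
        Real.exp (-α * ‖x - y‖ ^ 2) * (4 * α ^ 2 * ⟪e, x - y⟫ ^ 2 - 2 * α) := by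
    intro e he
    rw [← (contDiff_exp_neg_mul_norm_sub_sq α y).contDiffAt.deriv_deriv_comp_add_smul]
    set b := ⟪e, x - y⟫ with hb
    have h0 : (fun t : ℝ => Real.exp (-α * ‖x + t • e - y‖ ^ 2)) =
        fun t => Real.exp (-α * (‖x - y‖ ^ 2 + 2 * b * t + t ^ 2)) := by
      funext t
      have : x + t • e - y = (x - y) + t • e := by abel
      rw [this, norm_add_sq_real, norm_smul, he, inner_smul_right, real_inner_comm, ← hb]
      simp only [mul_one, Real.norm_eq_abs, sq_abs]
      ring_nf
    have hq : ∀ t : ℝ, HasDerivAt (fun t : ℝ => -α * (‖x - y‖ ^ 2 + 2 * b * t + t ^ 2))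
        (-α * (2 * b + 2 * t)) t := fun t => by
      have := ((((hasDerivAt_id t).const_mul (2 * b)).const_add (‖x - y‖ ^ 2)).add
        ((hasDerivAt_id t).pow 2)).const_mul (-α)
      simpa using this
    have h1 : deriv (fun t : ℝ => Real.exp (-α * (‖x - y‖ ^ 2 + 2 * b * t + t ^ 2))) =
        fun t => Real.exp (-α * (‖x - y‖ ^ 2 + 2 * b * t + t ^ 2)) * (-α * (2 * b + 2 * t)) :=
      funext fun t => (hq t).exp.deriv
    have hl : HasDerivAt (fun t : ℝ => -α * (2 * b + 2 * t)) (-α * 2) 0 := by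
      simpa using (((hasDerivAt_id (0 : ℝ)).const_mul 2).const_add (2 * b)).const_mul (-α)
    rw [h0, h1]
    refine ((hq 0).exp.mul hl).deriv.trans ?_
    simp only [mul_zero, add_zero, ne_eq, OfNat.ofNat_ne_zero, not_false_eq_true, zero_pow]
    ring
  rw [InnerProductSpace.laplacian_eq_iteratedFDeriv_stdOrthonormalBasis]
  simp only
  rw [Finset.sum_congr rfl fun i _ => key _ ((stdOrthonormalBasis ℝ E).norm_eq_one i),
    ← Finset.mul_sum, Finset.sum_sub_distrib, ← Finset.mul_sum]
  have := (stdOrthonormalBasis ℝ E).sum_sq_norm_inner_right (x - y)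
  simp only [Real.norm_eq_abs, sq_abs] at this
  rw [this]
  simp
  ring_nf

/-- Hopf's boundary point lemma: if `v` is subharmonic in a ball and attains its maximum over the
closed ball only at the boundary point `x₁`, then its outward radial derivative at `x₁` is positive.
For small `ε` the function `v + ε * exp (-α * ‖z - y‖ ^ 2)` is still maximal at `x₁` over the annulus
`R / 2 ≤ ‖z - y‖ ≤ R`, and the barrier has negative radial derivative at `x₁`. -/
theorem hopf_boundary_point {v : E → ℝ} {y x₁ : E} {R : ℝ} (hR : 0 < R)
    (hx₁ : ‖x₁ - y‖ = R) (hvc : ContinuousOn v (Metric.closedBall y R))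
    (hv : ∀ x ∈ Metric.ball y R, ContDiffAt ℝ 2 v x)
    (hsub : ∀ x ∈ Metric.ball y R, 0 ≤ Laplacian.laplacian v x)
    (hlt : ∀ x ∈ Metric.closedBall y R, x ≠ x₁ → v x < v x₁)
    {L : E →L[ℝ] ℝ} (hL : HasFDerivWithinAt v L (Metric.closedBall y R) x₁) :
    0 < L (x₁ - y) := by
  -- With this `α` the barrier `b` has positive Laplacian for `R / 2 < ‖z - y‖`.
  set n : ℝ := (Module.finrank ℝ E : ℝ) with hn
  have hn0 : 0 ≤ n := Nat.cast_nonneg _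
  set α : ℝ := (2 * n + 1) / R ^ 2 with hα
  have hα0 : 0 < α := by positivity
  have hαR : α * R ^ 2 = 2 * n + 1 := by rw [hα]; field_simp
  set b : E → ℝ := fun z => Real.exp (-α * ‖z - y‖ ^ 2) with hb
  have hbC : ContDiff ℝ 2 b := contDiff_exp_neg_mul_norm_sub_sq α y
  have hb1 : ∀ z, b z ≤ 1 := fun z => by
    rw [hb, Real.exp_le_one_iff]
    nlinarith [sq_nonneg ‖z - y‖]
  -- On the inner sphere, `v` stays below `v x₁` by a uniform gap.
  obtain ⟨ε, hε, hgap⟩ : ∃ ε > 0, ∀ z ∈ Metric.sphere y (R / 2), v z + ε < v x₁ := by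
    have hS : Metric.sphere y (R / 2) ⊆ Metric.closedBall y R := fun z hz => by
      rw [Metric.mem_closedBall, Metric.mem_sphere.1 hz]; linarith
    have hne : ∀ z ∈ Metric.sphere y (R / 2), v z < v x₁ := fun z hz => by
      refine hlt z (hS hz) ?_
      rintro rfl
      rw [mem_sphere_iff_norm] at hz
      linarith
    rcases (Metric.sphere y (R / 2)).eq_empty_or_nonempty with h | h
    · exact ⟨1, one_pos, by simp [h]⟩
    · obtain ⟨z, hz, hzmax⟩ := (isCompact_sphere y (R / 2)).exists_isMaxOn h (hvc.mono hS)
      refine ⟨(v x₁ - v z) / 2, by linarith [hne z hz], fun w hw => ?_⟩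
      have : v w ≤ v z := hzmax hw
      linarith [hne z hz]
  set K : Set E := Metric.closedBall y R \ Metric.ball y (R / 2) with hK
  have hKc : IsCompact K := (isCompact_closedBall y R).diff Metric.isOpen_ball
  have hx₁K : x₁ ∈ K := by
    simp only [hK, Set.mem_sdiff, mem_closedBall_iff_norm, mem_ball_iff_norm, hx₁]
    constructor <;> linarith
  have hfc : ContinuousOn (fun z => v z + ε * b z) K :=
    (hvc.mono Set.sdiff_subset).add (continuousOn_const.mul hbC.continuous.continuousOn)
  have hmax : IsMaxOn (fun z => v z + ε * b z) K x₁ := by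
    obtain ⟨z, hz, hzmax⟩ := hKc.exists_isMaxOn ⟨x₁, hx₁K⟩ hfc
    obtain ⟨hzR, hzr⟩ := hz
    have hz1 : v x₁ + ε * b x₁ ≤ v z + ε * b z := hzmax hx₁K
    rw [mem_closedBall_iff_norm] at hzR
    rw [mem_ball_iff_norm, not_lt] at hzr
    rcases hzR.eq_or_lt with hzR' | hzR'
    · -- On the outer sphere the barrier is constant.
      have hbz : b z = b x₁ := by simp only [hb, hzR', hx₁]
      have hvz : v z ≤ v x₁ := by
        rcases eq_or_ne z x₁ with rfl | hne
        · rfl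
        · exact (hlt z (by rw [mem_closedBall_iff_norm]; exact hzR) hne).le
      intro w hw
      have := hzmax hw
      simp only [Set.mem_ofPred_eq] at this ⊢
      rw [hbz] at this
      linarith
    rcases hzr.eq_or_lt with hzr' | hzr'
    · -- On the inner sphere the gap `ε` is at least `ε * b`, because `b ≤ 1`.
      exfalso
      have h1 := hgap z (by rw [mem_sphere_iff_norm]; exact hzr'.symm)
      have h2 : 0 < ε * b x₁ := mul_pos hε (Real.exp_pos _)
      have h3 : ε * b z ≤ ε * 1 := mul_le_mul_of_nonneg_left (hb1 z) hε.le
      linarith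
    · -- In the open annulus the sum has positive Laplacian, so it has no local maximum.
      exfalso
      have hzb : z ∈ Metric.ball y R := by rw [mem_ball_iff_norm]; exact hzR'
      have hKn : K ∈ 𝓝 z := by
        refine mem_of_superset ((Metric.isOpen_ball.sdiff
          Metric.isClosed_closedBall).mem_nhds (x := z) (s := Metric.ball y R \
            Metric.closedBall y (R / 2)) ⟨hzb, ?_⟩) (Set.sdiff_subset_sdiff
            Metric.ball_subset_closedBall Metric.ball_subset_closedBall)
        rw [mem_closedBall_iff_norm, not_le]
        exact hzr'
      have hloc : IsLocalMax (v + ε • b) z := hzmax.isLocalMax hKn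
      have hεb : ContDiffAt ℝ 2 (ε • b) z := (contDiff_const.smul hbC).contDiffAt
      have h1 := hloc.laplacian_nonpos ((hv z hzb).add hεb)
      rw [(hv z hzb).laplacian_add hεb, InnerProductSpace.laplacian_smul ε hbC.contDiffAt,
        laplacian_exp_neg_mul_norm_sub_sq, smul_eq_mul] at h1
      have h2 := hsub z hzb
      have h3 : 0 < 4 * α ^ 2 * ‖z - y‖ ^ 2 - 2 * α * n := by
        have : R ^ 2 < 4 * ‖z - y‖ ^ 2 := by nlinarith
        have : α * R ^ 2 ≤ α * (4 * ‖z - y‖ ^ 2) := by gcongr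
        have : 0 < α * (α * (4 * ‖z - y‖ ^ 2) - 2 * n) := mul_pos hα0 (by linarith)
        nlinarith
      have h4 := mul_pos hε (mul_pos (Real.exp_pos (-α * ‖z - y‖ ^ 2)) h3)
      linarith
  -- Compare the derivative at `x₁` along the radius pointing into the annulus.
  have hder : HasFDerivWithinAt (fun z => v z + ε * b z) _ K x₁ :=
    (hL.mono Set.sdiff_subset).add
      ((hasFDerivAt_exp_neg_mul_norm_sub_sq α y x₁).hasFDerivWithinAt.const_mul ε)
  have hcone : (1 / 2 : ℝ) • (y - x₁) ∈ posTangentConeAt K x₁ := by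
    apply mem_posTangentConeAt_of_segment_subset
    rw [segment_eq_image']
    rintro _ ⟨t, ⟨ht0, ht1⟩, rfl⟩
    have hnorm : ‖x₁ + t • (x₁ + (1 / 2 : ℝ) • (y - x₁) - x₁) - y‖ = (1 - t / 2) * R := by
      have : x₁ + t • (x₁ + (1 / 2 : ℝ) • (y - x₁) - x₁) - y = (1 - t / 2) • (x₁ - y) := by
        module
      rw [this, norm_smul, hx₁, Real.norm_eq_abs, abs_of_nonneg (by linarith)]
    simp only [hK, Set.mem_sdiff, mem_closedBall_iff_norm, mem_ball_iff_norm, hnorm]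
    constructor <;> nlinarith
  have hle := hmax.localize.hasFDerivWithinAt_nonpos hder hcone
  have hyx : y - x₁ = -(x₁ - y) := by abel
  rw [hyx] at hle
  simp only [map_smul, map_neg, add_apply, smul_apply,
    innerSL_apply_apply, real_inner_self_eq_norm_sq, hx₁, smul_eq_mul, nsmul_eq_mul] at hle
  have hpos : 0 < ε * (Real.exp (-α * R ^ 2) * (α * (2 * R ^ 2))) := by positivity
  push_cast at hle
  nlinarith

end MaximumPrinciple

/-! ### The interior ball condition -/

section InteriorBall

/-- If `Ω = {ρ < 0}` near a zero `x₀` of `ρ` with nonzero gradient, then a closed ball centred on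
the inner normal line touches the complement of `Ω` at `x₀` only: on the ball of radius `R`, the linear
part of `ρ (x₀ + h)` is at most `-‖∇ ρ x₀‖ * ‖h‖ ^ 2 / (2 * R)`, which beats the Taylor remainder
`C * ‖h‖ ^ 2` when `R` is small. -/
theorem exists_closedBall_subset_of_contDiffAt {E : Type*} [NormedAddCommGroup E]
    [InnerProductSpace ℝ E] [CompleteSpace E] {Ω : Set E} {ρ : E → ℝ} {x₀ : E}
    (hρ : ContDiffAt ℝ 2 ρ x₀) (h0 : ρ x₀ = 0) (hgrad : ∇ ρ x₀ ≠ 0)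
    (hΩ : ∀ᶠ y in 𝓝 x₀, y ∈ Ω ↔ ρ y < 0) :
    ∃ R > 0, ∀ x ∈ Metric.closedBall (x₀ - R • (‖∇ ρ x₀‖⁻¹ • ∇ ρ x₀)) R, x ≠ x₀ → x ∈ Ω := by
  obtain ⟨C, s, hs, hC⟩ :=
    (hρ.fderiv_right (m := 1) (by norm_num)).exists_lipschitzOnWith
  obtain ⟨δ, hδ, hball⟩ := Metric.eventually_nhds_iff_ball.1
    ((hΩ.and hs).and (hρ.eventually (by simp)))
  -- Second order Taylor estimate, from the Lipschitz bound on the derivative.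
  have htaylor : ∀ x ∈ Metric.ball x₀ δ,
      ‖ρ x - ρ x₀ - fderiv ℝ ρ x₀ (x - x₀)‖ ≤ C * ‖x - x₀‖ * ‖x - x₀‖ := by
    intro x hx
    have hsub : Metric.closedBall x₀ ‖x - x₀‖ ⊆ Metric.ball x₀ δ :=
      Metric.closedBall_subset_ball (by rwa [mem_ball_iff_norm] at hx)
    refine (convex_closedBall x₀ ‖x - x₀‖).norm_image_sub_le_of_norm_fderiv_le'
      (fun z hz => (hball z (hsub hz)).2.differentiableAt (by simp)) (fun z hz => ?_)
      (Metric.mem_closedBall_self (norm_nonneg _)) (by rw [mem_closedBall_iff_norm])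
    calc ‖fderiv ℝ ρ z - fderiv ℝ ρ x₀‖ ≤ C * ‖z - x₀‖ := by
          simpa [dist_eq_norm] using hC.dist_le_mul z (hball z (hsub hz)).1.2 x₀
            (hball x₀ (Metric.mem_ball_self hδ)).1.2
      _ ≤ C * ‖x - x₀‖ := by
          gcongr
          rwa [mem_closedBall_iff_norm] at hz
  set G := ‖∇ ρ x₀‖ with hG
  have hG0 : 0 < G := norm_pos_iff.2 hgrad
  set ν := G⁻¹ • ∇ ρ x₀ with hν
  have hνnorm : ‖ν‖ = 1 := by
    rw [hν, norm_smul, norm_inv, norm_norm, ← hG, inv_mul_cancel₀ hG0.ne']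
  have hfd : ∀ h, fderiv ℝ ρ x₀ h = G * ⟪ν, h⟫ := fun h => by
    have h1 : ⟪∇ ρ x₀, h⟫ = fderiv ℝ ρ x₀ h := by
      simp [gradient, InnerProductSpace.toDual_symm_apply]
    rw [hν, inner_smul_left, ← h1]
    simp [hG0.ne']
  have hC0 : (0 : ℝ) ≤ C := C.2
  -- The radius is small compared with the inverse of the curvature bound `C / G`.
  obtain ⟨R, hR, hRδ, hRC⟩ : ∃ R > 0, 2 * R < δ ∧ 2 * R * C < G := by
    refine ⟨min (δ / 4) (G / (4 * (C + 1))), by positivity, ?_, ?_⟩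
    · linarith [min_le_left (δ / 4) (G / (4 * (C + 1)))]
    · have h1 := min_le_right (δ / 4) (G / (4 * ((C : ℝ) + 1)))
      rw [le_div_iff₀ (by positivity)] at h1
      have : 0 < min (δ / 4) (G / (4 * ((C : ℝ) + 1))) := by positivity
      nlinarith
  refine ⟨R, hR, fun x hx hne => ?_⟩
  rw [mem_closedBall_iff_norm] at hx
  have hh : 0 < ‖x - x₀‖ := norm_pos_iff.2 (sub_ne_zero.2 hne)
  have hsq : ‖x - x₀‖ ^ 2 + 2 * R * ⟪ν, x - x₀⟫ ≤ 0 := by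
    have h1 : x - (x₀ - R • ν) = (x - x₀) + R • ν := by abel
    have h2 : ‖(x - x₀) + R • ν‖ ^ 2 ≤ R ^ 2 := by
      rw [← h1]; gcongr
    rw [norm_add_sq_real, norm_smul, hνnorm, inner_smul_right, real_inner_comm] at h2
    simp only [mul_one, Real.norm_eq_abs, sq_abs] at h2
    linarith
  have hxδ : x ∈ Metric.ball x₀ δ := by
    rw [mem_ball_iff_norm]
    have h1 : x - x₀ = (x - (x₀ - R • ν)) - R • ν := by abel
    have h2 : ‖R • ν‖ = R := by rw [norm_smul, hνnorm, mul_one, Real.norm_of_nonneg hR.le]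
    calc ‖x - x₀‖ ≤ ‖x - (x₀ - R • ν)‖ + ‖R • ν‖ := by rw [h1]; exact norm_sub_le _ _
      _ < δ := by linarith
  rw [(hball x hxδ).1.1]
  have h3 := (abs_le.1 (htaylor x hxδ)).2
  rw [h0, hfd] at h3
  have h4 : 0 < ‖x - x₀‖ ^ 2 := by positivity
  have h5 : 2 * R * ρ x ≤ (2 * R * C - G) * ‖x - x₀‖ ^ 2 := by nlinarith
  have h6 : (2 * R * C - G) * ‖x - x₀‖ ^ 2 < 0 := mul_neg_of_neg_of_pos (by linarith) h4
  by_contra! hcon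
  have : 0 ≤ 2 * R * ρ x := by positivity
  linarith

variable {N : ℕ} {Ω : Set (EuclideanSpace ℝ (Fin N))}

/-- A `C^2` domain satisfies the interior ball condition, with the centre on the line of an outer
unit normal in the sense of `IsOuterUnitNormal`. -/
theorem IsC2Domain.exists_closedBall (hΩ : IsC2Domain Ω) {x₀ : EuclideanSpace ℝ (Fin N)}
    (hx₀ : x₀ ∈ frontier Ω) :
    ∃ ν, IsOuterUnitNormal Ω x₀ ν ∧ ‖ν‖ = 1 ∧
      ∃ R > 0, ∀ x ∈ Metric.closedBall (x₀ - R • ν) R, x ≠ x₀ → x ∈ Ω := by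
  obtain ⟨e, he, γ, hγ, r, hr, hmem⟩ := hΩ.2 x₀ hx₀
  set ρ : EuclideanSpace ℝ (Fin N) → ℝ := fun x => ⟪x, e⟫ - γ (x - ⟪x, e⟫ • e) with hρdef
  have hin : ContDiff ℝ 2 fun x : EuclideanSpace ℝ (Fin N) => ⟪x, e⟫ :=
    contDiff_id.inner ℝ contDiff_const
  have hproj : ContDiff ℝ 2 fun x : EuclideanSpace ℝ (Fin N) => x - ⟪x, e⟫ • e :=
    contDiff_id.sub (hin.smul contDiff_const)
  have hρ : ContDiff ℝ 2 ρ := hin.sub (hγ.comp hproj)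
  have hiff : ∀ᶠ y in 𝓝 x₀, y ∈ Ω ↔ ρ y < 0 := by
    filter_upwards [Metric.ball_mem_nhds x₀ hr] with y hy
    rw [hmem y hy, hρdef, sub_neg]
  have h0 : ρ x₀ = 0 := by
    apply le_antisymm
    · have hfreq : ∃ᶠ y in 𝓝 x₀, y ∈ Ω :=
        mem_closure_iff_frequently.1 (frontier_subset_closure hx₀)
      exact le_of_tendsto_of_frequently (hρ.continuous.tendsto x₀)
        ((hfreq.and_eventually hiff).mono fun y hy => (hy.2.1 hy.1).le)
    · rw [hΩ.1.frontier_eq] at hx₀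
      exact not_lt.1 fun h => hx₀.2 (hiff.self_of_nhds.2 h)
  -- Moving in the direction `e` leaves the projection fixed, so `ρ` has derivative `1` along `e`.
  have hgrad : ∇ ρ x₀ ≠ 0 := by
    intro hz
    have h1 : HasDerivAt (fun t : ℝ => ρ (x₀ + t • e)) (fderiv ℝ ρ x₀ e) 0 := by
      have hl : HasDerivAt (fun t : ℝ => x₀ + t • e) e 0 := by
        simpa using ((hasDerivAt_id (0 : ℝ)).smul_const e).const_add x₀
      have hf : HasFDerivAt ρ (fderiv ℝ ρ x₀) (x₀ + (0 : ℝ) • e) := by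
        simpa using (hρ.contDiffAt.differentiableAt (by simp)).hasFDerivAt
      exact hf.comp_hasDerivAt 0 hl
    have h2 : (fun t : ℝ => ρ (x₀ + t • e)) = fun t => t + ρ x₀ := by
      funext t
      have hi : ⟪x₀ + t • e, e⟫ = ⟪x₀, e⟫ + t := by
        rw [inner_add_left, real_inner_smul_left, real_inner_self_eq_norm_sq, he]; ring
      have hp : x₀ + t • e - (⟪x₀, e⟫ + t) • e = x₀ - ⟪x₀, e⟫ • e := by module
      simp only [hρdef, hi, hp]
      ring
    rw [h2] at h1
    have h3 := h1.unique ((hasDerivAt_id (0 : ℝ)).add_const (ρ x₀))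
    have h4 : ⟪∇ ρ x₀, e⟫ = fderiv ℝ ρ x₀ e := by
      simp [gradient, InnerProductSpace.toDual_symm_apply]
    rw [hz, inner_zero_left, h3] at h4
    exact zero_ne_one h4
  obtain ⟨R, hR, hball⟩ := exists_closedBall_subset_of_contDiffAt hρ.contDiffAt h0 hgrad hiff
  refine ⟨_, ⟨ρ, hρ.contDiffAt.of_le (by norm_num), hiff, h0, hgrad, rfl⟩, ?_, R, hR, hball⟩
  rw [norm_smul, norm_inv, norm_norm, inv_mul_cancel₀ (norm_ne_zero_iff.2 hgrad)]

/-- The interior ball condition makes derivatives within `closure Ω` unique, so that they depend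
linearly on the function. -/
theorem IsC2Domain.uniqueDiffOn_closure (hΩ : IsC2Domain Ω) : UniqueDiffOn ℝ (closure Ω) := by
  intro x hx
  by_cases hxΩ : x ∈ Ω
  · exact (hΩ.1.uniqueDiffWithinAt hxΩ).mono subset_closure
  have hxf : x ∈ frontier Ω := by rw [hΩ.1.frontier_eq]; exact ⟨hx, hxΩ⟩
  obtain ⟨ν, -, hν, R, hR, hball⟩ := hΩ.exists_closedBall hxf
  have hmem : x ∈ Metric.closedBall (x - R • ν) R := by
    rw [mem_closedBall_iff_norm, sub_sub_cancel, norm_smul, hν, mul_one, Real.norm_of_nonneg hR.le]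
  refine (uniqueDiffWithinAt_convex (convex_closedBall (x - R • ν) R) ?_
    (subset_closure hmem)).mono fun z hz => ?_
  · exact ⟨x - R • ν, Metric.ball_subset_interior_closedBall (Metric.mem_ball_self hR)⟩
  · by_cases h : z = x
    · rwa [h]
    · exact subset_closure (hball z hz h)

end InteriorBall

/-! ### The strong maximum principle under the Neumann condition -/

section Neumann

variable {N : ℕ} {Ω : Set (EuclideanSpace ℝ (Fin N))} {v w : EuclideanSpace ℝ (Fin N) → ℝ}

/-- Local form of Hopf's lemma: it suffices that `v` is subharmonic in `Ω` near the touching point,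
since the ball can be shrunk towards that point. -/
theorem fderivWithin_closure_pos_of_touching_ball {x₁ y : EuclideanSpace ℝ (Fin N)} {R : ℝ}
    (hΩ : IsOpen Ω) (hv : ContDiffOn ℝ 2 v (closure Ω)) (hx₁ : x₁ ∈ closure Ω) (hR : 0 < R)
    (hx₁y : ‖x₁ - y‖ = R)
    (hball : ∀ x ∈ Metric.closedBall y R, x ≠ x₁ → x ∈ Ω ∧ v x < v x₁)
    (hsub : ∀ᶠ x in 𝓝[Ω] x₁, 0 ≤ Laplacian.laplacian v x) :
    0 < fderivWithin ℝ v (closure Ω) x₁ (x₁ - y) := by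
  obtain ⟨δ, hδ, hδsub⟩ := Metric.eventually_nhds_iff_ball.1 (eventually_nhdsWithin_iff.1 hsub)
  -- Shrink the ball towards `x₁`, into the region where `v` is subharmonic.
  obtain ⟨s, hs0, hs1, hsδ⟩ : ∃ s > 0, s ≤ 1 ∧ 2 * (s * R) < δ := by
    refine ⟨min 1 (δ / (4 * R)), by positivity, min_le_left _ _, ?_⟩
    have h := min_le_right 1 (δ / (4 * R))
    rw [le_div_iff₀ (by positivity)] at h
    linarith
  set y' := x₁ + s • (y - x₁) with hy'
  have hx₁y' : x₁ - y' = s • (x₁ - y) := by rw [hy']; module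
  have hnorm : ‖x₁ - y'‖ = s * R := by
    rw [hx₁y', norm_smul, hx₁y, Real.norm_of_nonneg hs0.le]
  have hyy' : ‖y' - y‖ = (1 - s) * R := by
    have : y' - y = (1 - s) • (x₁ - y) := by rw [hy']; module
    rw [this, norm_smul, hx₁y, Real.norm_of_nonneg (by linarith)]
  have hsubset : Metric.closedBall y' (s * R) ⊆ Metric.closedBall y R := by
    apply Metric.closedBall_subset_closedBall'
    rw [dist_eq_norm, hyy']
    linarith
  have hne : ∀ z ∈ Metric.ball y' (s * R), z ≠ x₁ := by
    rintro z hz rfl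
    rw [mem_ball_iff_norm] at hz
    linarith
  have hin : ∀ z ∈ Metric.ball y' (s * R), z ∈ Ω := fun z hz =>
    (hball z (hsubset (Metric.ball_subset_closedBall hz)) (hne z hz)).1
  have hcl : Metric.closedBall y' (s * R) ⊆ closure Ω := fun z hz => by
    by_cases h : z = x₁
    · rwa [h]
    · exact subset_closure (hball z (hsubset hz) h).1
  have hpos := hopf_boundary_point (v := v) (mul_pos hs0 hR) hnorm (hv.continuousOn.mono hcl)
    (fun z hz => (hv.mono subset_closure).contDiffAt (hΩ.mem_nhds (hin z hz)))
    (fun z hz => hδsub z (by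
      rw [Metric.mem_ball] at hz ⊢
      have := dist_triangle z y' x₁
      rw [dist_comm y' x₁, dist_eq_norm x₁ y', hnorm] at this
      linarith) (hin z hz))
    (fun z hz h => (hball z (hsubset hz) h).2)
    (((hv x₁ hx₁).differentiableWithinAt (by simp)).hasFDerivWithinAt.mono hcl)
  rw [hx₁y', map_smul, smul_eq_mul] at hpos
  exact pos_of_mul_pos_right hpos hs0.le

/-- The set of interior maximum points is open. Otherwise a ball around a nearby non-maximum point
touches this set at some `x₁`, where Hopf's lemma contradicts the vanishing of the gradient. -/
theorem eventually_eq_of_isMaxOn_closure {p : EuclideanSpace ℝ (Fin N)} {M : ℝ}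
    (hΩ : IsOpen Ω) (hv : ContDiffOn ℝ 2 v (closure Ω)) (hM : ∀ x ∈ closure Ω, v x ≤ M)
    (hsub : ∀ x ∈ closure Ω, v x = M → ∀ᶠ z in 𝓝[Ω] x, 0 ≤ Laplacian.laplacian v z)
    (hp : p ∈ Ω) (hvp : v p = M) : ∀ᶠ x in 𝓝 p, v x = M := by
  by_contra hcon
  obtain ⟨r, hr, hrΩ⟩ := Metric.nhds_basis_closedBall.mem_iff.1 (hΩ.mem_nhds hp)
  obtain ⟨q, hq, hqr⟩ := ((not_eventually.1 hcon).and_eventually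
    (Metric.ball_mem_nhds p (half_pos hr))).exists
  have hcont : ContinuousOn v (Metric.closedBall p r) :=
    hv.continuousOn.mono (hrΩ.trans subset_closure)
  -- `x₁` is a point of the maximum set nearest to `q`.
  have hK : IsCompact (Metric.closedBall p r ∩ v ⁻¹' {M}) :=
    (isCompact_closedBall p r).of_isClosed_subset
      (hcont.preimage_isClosed_of_isClosed Metric.isClosed_closedBall isClosed_singleton)
      Set.inter_subset_left
  obtain ⟨x₁, ⟨hx₁r, hx₁M⟩, hmin⟩ := hK.exists_isMinOn ⟨p, Metric.mem_closedBall_self hr.le, hvp⟩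
    (f := fun x => dist x q) (by fun_prop)
  replace hx₁M : v x₁ = M := hx₁M
  have hx₁Ω : x₁ ∈ Ω := hrΩ hx₁r
  set R := dist x₁ q with hRdef
  have hR : 0 < R := dist_pos.2 fun h => hq (h ▸ hx₁M)
  have hRr : R < r / 2 := by
    have : dist x₁ q ≤ dist p q := hmin ⟨Metric.mem_closedBall_self hr.le, hvp⟩
    rw [dist_comm p q] at this
    linarith
  have hlt : ∀ z ∈ Metric.ball q R, z ∈ Ω ∧ v z < v x₁ := by
    intro z hz
    rw [Metric.mem_ball] at hz
    have hzr : z ∈ Metric.closedBall p r := by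
      rw [Metric.mem_closedBall]
      linarith [dist_triangle z q p]
    refine ⟨hrΩ hzr, hx₁M ▸ (hM z (subset_closure (hrΩ hzr))).lt_of_ne fun h => ?_⟩
    have : R ≤ dist z q := hmin ⟨hzr, h⟩
    linarith
  -- The ball of half the radius touches the maximum set at `x₁` only.
  set y := midpoint ℝ x₁ q with hy
  have hx₁y : ‖x₁ - y‖ = R / 2 := by
    rw [← dist_eq_norm, hy, dist_left_midpoint, ← hRdef]
    norm_num
    ring
  have hball : ∀ z ∈ Metric.closedBall y (R / 2), z ≠ x₁ → z ∈ Ω ∧ v z < v x₁ := by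
    intro z hz hne
    refine hlt z ?_
    have hyq : y - q = x₁ - y := by
      rw [hy, midpoint_eq_smul_add, invOf_eq_inv]
      module
    rw [mem_closedBall_iff_norm] at hz
    rw [mem_ball_iff_norm]
    have hzq : z - q = (z - y) + (x₁ - y) := by rw [← hyq]; abel
    have hsum := norm_add_sq_real (z - y) (x₁ - y)
    have hdiff := norm_sub_sq_real (z - y) (x₁ - y)
    rw [sub_sub_sub_cancel_right] at hdiff
    have hpos : 0 < ‖z - x₁‖ := norm_pos_iff.2 (sub_ne_zero.2 hne)
    rw [hzq]
    refine lt_of_pow_lt_pow_left₀ 2 hR.le ?_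
    rw [hx₁y] at hsum hdiff
    have : ‖z - y‖ ^ 2 ≤ (R / 2) ^ 2 := by gcongr
    nlinarith [pow_pos hpos 2]
  have hder := fderivWithin_closure_pos_of_touching_ball hΩ hv (subset_closure hx₁Ω) (half_pos hR)
    hx₁y hball (hsub x₁ (subset_closure hx₁Ω) hx₁M)
  have hloc : IsLocalMax v x₁ := by
    filter_upwards [hΩ.mem_nhds hx₁Ω] with z hz
    rw [hx₁M]
    exact hM z (subset_closure hz)
  rw [fderivWithin_of_mem_nhds (mem_of_superset (hΩ.mem_nhds hx₁Ω) subset_closure),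
    hloc.fderiv_eq_zero] at hder
  simp at hder

/-- Strong maximum principle for the Neumann problem: a function which is subharmonic near its
maximum points and has zero normal derivative is constant. -/
theorem exists_eq_const_of_neumann (hΩ : IsC2Domain Ω) (hΩb : Bornology.IsBounded Ω)
    (hΩc : IsConnected Ω) (hv : ContDiffOn ℝ 2 v (closure Ω)) (hbdry : NeumannCondition Ω v)
    (hsub : ∀ x ∈ closure Ω, IsMaxOn v (closure Ω) x →
      ∀ᶠ z in 𝓝[Ω] x, 0 ≤ Laplacian.laplacian v z) :
    ∃ c : ℝ, ∀ x ∈ closure Ω, v x = c := by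
  obtain ⟨x₀, hx₀, hmax⟩ :=
    hΩb.isCompact_closure.exists_isMaxOn hΩc.nonempty.closure hv.continuousOn
  refine ⟨v x₀, ?_⟩
  have hM : ∀ x ∈ closure Ω, v x ≤ v x₀ := fun x hx => hmax hx
  have hsub' : ∀ x ∈ closure Ω, v x = v x₀ →
      ∀ᶠ z in 𝓝[Ω] x, 0 ≤ Laplacian.laplacian v z := fun x hx hvx =>
    hsub x hx fun z hz => (hM z hz).trans_eq hvx.symm
  suffices h : ∀ x ∈ Ω, v x = v x₀ from fun x hx =>
    Set.EqOn.of_subset_closure (g := fun _ => v x₀) h hv.continuousOn continuousOn_const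
      subset_closure subset_rfl hx
  by_cases hA : ∃ p ∈ Ω, v p = v x₀
  · -- The set of interior maximum points is open and relatively closed.
    obtain ⟨p, hp, hvp⟩ := hA
    have hU : IsOpen {x | x ∈ Ω ∧ v x = v x₀} := isOpen_iff_mem_nhds.2 fun x hx =>
      Filter.Eventually.and (hΩ.1.mem_nhds hx.1)
        (eventually_eq_of_isMaxOn_closure hΩ.1 hv hM hsub' hx.1 hx.2)
    have hV : IsOpen (Ω ∩ v ⁻¹' {v x₀}ᶜ) :=
      (hv.continuousOn.mono subset_closure).isOpen_inter_preimage hΩ.1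
        isClosed_singleton.isOpen_compl
    have := hΩc.isPreconnected.subset_left_of_subset_union hU hV
      (Set.disjoint_left.2 fun x hx hx' => hx'.2 hx.2)
      (fun x hx => (em (v x = v x₀)).imp (fun h => ⟨hx, h⟩) fun h => ⟨hx, h⟩) ⟨p, hp, hp, hvp⟩
    exact fun x hx => (this hx).2
  · -- Otherwise the maximum is attained on the boundary only, against Hopf's lemma.
    exfalso
    push Not at hA
    have hx₀Ω : x₀ ∉ Ω := fun h => hA x₀ h rfl
    have hx₀f : x₀ ∈ frontier Ω := by rw [hΩ.1.frontier_eq]; exact ⟨hx₀, hx₀Ω⟩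
    obtain ⟨ν, hν, hν1, R, hR, hball⟩ := hΩ.exists_closedBall hx₀f
    have hpos := fderivWithin_closure_pos_of_touching_ball (y := x₀ - R • ν) hΩ.1 hv hx₀ hR
      (by rw [sub_sub_cancel, norm_smul, hν1, mul_one, Real.norm_of_nonneg hR.le])
      (fun z hz hne => ⟨hball z hz hne, (hM z (subset_closure (hball z hz hne))).lt_of_ne
        (hA z (hball z hz hne))⟩) (hsub' x₀ hx₀ rfl)
    rw [sub_sub_cancel, map_smul, hbdry x₀ hx₀f ν hν, smul_zero] at hpos
    exact lt_irrefl _ hpos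

theorem NeumannCondition.add (hΩ : IsC2Domain Ω) (hv : ContDiffOn ℝ 2 v (closure Ω))
    (hw : ContDiffOn ℝ 2 w (closure Ω)) (hvn : NeumannCondition Ω v)
    (hwn : NeumannCondition Ω w) : NeumannCondition Ω (v + w) := by
  intro x hx ν hν
  have hxc := frontier_subset_closure hx
  rw [fderivWithin_add (hΩ.uniqueDiffOn_closure x hxc)
    ((hv x hxc).differentiableWithinAt (by simp)) ((hw x hxc).differentiableWithinAt (by simp))]
  simp [hvn x hx ν hν, hwn x hx ν hν]

theorem NeumannCondition.const_smul (hΩ : IsC2Domain Ω) (hv : ContDiffOn ℝ 2 v (closure Ω))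
    (hvn : NeumannCondition Ω v) (a : ℝ) : NeumannCondition Ω (a • v) := by
  intro x hx ν hν
  have hxc := frontier_subset_closure hx
  rw [fderivWithin_const_smul (hΩ.uniqueDiffOn_closure x hxc)
    ((hv x hxc).differentiableWithinAt (by simp))]
  simp [hvn x hx ν hν]

/-- A harmonic linear combination of two functions satisfying the Neumann condition is constant. -/
theorem exists_linearCombination_eq_const (hΩ : IsC2Domain Ω) (hΩb : Bornology.IsBounded Ω)
    (hΩc : IsConnected Ω) (hv : ContDiffOn ℝ 2 v (closure Ω))
    (hw : ContDiffOn ℝ 2 w (closure Ω)) (hvn : NeumannCondition Ω v)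
    (hwn : NeumannCondition Ω w) {a b : ℝ}
    (hlap : ∀ x ∈ Ω, a * Laplacian.laplacian v x + b * Laplacian.laplacian w x = 0) :
    ∃ c : ℝ, ∀ x ∈ closure Ω, a * v x + b * w x = c := by
  have hav : ContDiffOn ℝ 2 (a • v) (closure Ω) := contDiffOn_const.smul hv
  have hbw : ContDiffOn ℝ 2 (b • w) (closure Ω) := contDiffOn_const.smul hw
  refine exists_eq_const_of_neumann (v := a • v + b • w) hΩ hΩb hΩc (hav.add hbw)
    ((hvn.const_smul hΩ hv a).add hΩ hav hbw (hwn.const_smul hΩ hw b)) fun x _ _ => ?_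
  filter_upwards [self_mem_nhdsWithin] with z hz
  have hvz : ContDiffAt ℝ 2 v z := (hv.mono subset_closure).contDiffAt (hΩ.1.mem_nhds hz)
  have hwz : ContDiffAt ℝ 2 w z := (hw.mono subset_closure).contDiffAt (hΩ.1.mem_nhds hz)
  have haz : ContDiffAt ℝ 2 (a • v) z := contDiffAt_const.smul hvz
  have hbz : ContDiffAt ℝ 2 (b • w) z := contDiffAt_const.smul hwz
  rw [haz.laplacian_add hbz, InnerProductSpace.laplacian_smul a hvz,
    InnerProductSpace.laplacian_smul b hwz]
  exact (hlap z hz).ge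

end Neumann

/-! ### The reaction-diffusion system -/

theorem proposition6p1 {N : ℕ} (hN : 1 ≤ N) (Ω : Set (EuclideanSpace ℝ (Fin N)))
    (hΩ : IsC2Domain Ω) (hΩb : Bornology.IsBounded Ω) (hΩc : IsConnected Ω)
    (d : Fin 4 → ℝ) (hd : ∀ i, 0 < d i)
    (u : Fin 4 → EuclideanSpace ℝ (Fin N) → ℝ)
    (hu : ∀ i, ContDiffOn ℝ 2 (u i) (closure Ω))
    (hu_nonneg : ∀ i, ∀ x ∈ Ω, 0 ≤ u i x)
    -- the components `u₁, u₂, u₃, u₄` are `u 0, u 1, u 2, u 3`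
    (hu_eq : ∀ i : Fin 4, ∀ x ∈ Ω, -(d i) * Laplacian.laplacian (u i) x =
      (-1) ^ ((i : ℕ) + 1) * (u 0 x * u 2 x - u 1 x * u 3 x))
    (hu_bdry : ∀ i, NeumannCondition Ω (u i)) :
    ∀ i, ∃ c : ℝ, ∀ x ∈ closure Ω, u i x = c := by
  have e0 := hu_eq 0
  have e1 := hu_eq 1
  have e2 := hu_eq 2
  have e3 := hu_eq 3
  norm_num at e0 e1 e2 e3
  have hnn : ∀ i, ∀ x ∈ closure Ω, 0 ≤ u i x := fun i x hx => by
    have := mem_closure_iff_nhdsWithin_neBot.1 hx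
    exact ge_of_tendsto (((hu i).continuousOn x hx).mono subset_closure)
      (eventually_nhdsWithin_of_forall (hu_nonneg i))
  -- The conservation laws: `d 0 • u 0 + σ • d i • u i` is constant, with `σ = 1, -1, 1`
  -- for `i = 1, 2, 3`.
  have conserved : ∀ (i : Fin 4) (σ : ℝ), (∀ x ∈ Ω, d 0 * Laplacian.laplacian (u 0) x +
      σ * d i * Laplacian.laplacian (u i) x = 0) →
      ∃ c : ℝ, ∀ x ∈ closure Ω, d 0 * u 0 x + σ * d i * u i x = c := fun i σ h =>
    exists_linearCombination_eq_const hΩ hΩb hΩc (hu 0) (hu i) (hu_bdry 0) (hu_bdry i) h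
  obtain ⟨c1, hc1⟩ := conserved 1 1 fun x hx => by linarith [e0 x hx, e1 x hx]
  obtain ⟨c2, hc2⟩ := conserved 2 (-1) fun x hx => by linarith [e0 x hx, e2 x hx]
  obtain ⟨c3, hc3⟩ := conserved 3 1 fun x hx => by linarith [e0 x hx, e3 x hx]
  have hconst0 : ∃ c : ℝ, ∀ x ∈ closure Ω, u 0 x = c := by
    by_cases hw : ∃ z ∈ Ω, 0 < u 0 z * u 2 z - u 1 z * u 3 z
    · -- The reaction term increases with `u 0`, so it is positive near every maximum of `u 0`.
      obtain ⟨z, hz, hwz⟩ := hw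
      have hzc := subset_closure hz
      refine exists_eq_const_of_neumann hΩ hΩb hΩc (hu 0) (hu_bdry 0) fun x hx hmax => ?_
      have h0 : u 0 z ≤ u 0 x := hmax hzc
      have h0d : d 0 * u 0 z ≤ d 0 * u 0 x := mul_le_mul_of_nonneg_left h0 (hd 0).le
      have h1 : u 1 x ≤ u 1 z :=
        le_of_mul_le_mul_left (by linarith [hc1 x hx, hc1 z hzc]) (hd 1)
      have h2 : u 2 z ≤ u 2 x :=
        le_of_mul_le_mul_left (by linarith [hc2 x hx, hc2 z hzc]) (hd 2)
      have h3 : u 3 x ≤ u 3 z :=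
        le_of_mul_le_mul_left (by linarith [hc3 x hx, hc3 z hzc]) (hd 3)
      have hwx : 0 < u 0 x * u 2 x - u 1 x * u 3 x := by
        have := mul_le_mul h0 h2 (hnn 2 z hzc) (hnn 0 x hx)
        have := mul_le_mul h1 h3 (hnn 3 x hx) (hnn 1 z hzc)
        linarith
      have hcont : ContinuousOn (fun y => u 0 y * u 2 y - u 1 y * u 3 y) (closure Ω) :=
        ((hu 0).continuousOn.mul (hu 2).continuousOn).sub
          ((hu 1).continuousOn.mul (hu 3).continuousOn)
      filter_upwards [self_mem_nhdsWithin, ((hcont x hx).mono subset_closure).eventually_const_lt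
        hwx] with y hy hwy
      exact nonneg_of_mul_nonneg_right (by linarith [e0 y hy]) (hd 0)
    · -- Otherwise `u 0` is superharmonic.
      push Not at hw
      have hneg : ContDiffOn ℝ 2 ((-1 : ℝ) • u 0) (closure Ω) := contDiffOn_const.smul (hu 0)
      obtain ⟨c, hc⟩ := exists_eq_const_of_neumann hΩ hΩb hΩc hneg
        ((hu_bdry 0).const_smul hΩ (hu 0) (-1)) fun x _ _ => by
          filter_upwards [self_mem_nhdsWithin] with y hy
          rw [InnerProductSpace.laplacian_smul _
            (((hu 0).mono subset_closure).contDiffAt (hΩ.1.mem_nhds hy))]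
          refine nonneg_of_mul_nonneg_right (a := d 0) ?_ (hd 0)
          rw [smul_eq_mul]
          linarith [e0 y hy, hw y hy]
      refine ⟨-c, fun x hx => ?_⟩
      have := hc x hx
      simp only [Pi.smul_apply, smul_eq_mul] at this
      linarith
  obtain ⟨c, hc⟩ := hconst0
  have hconst : ∀ (i : Fin 4) (σ k : ℝ), σ ≠ 0 →
      (∀ x ∈ closure Ω, d 0 * u 0 x + σ * d i * u i x = k) →
      ∃ c : ℝ, ∀ x ∈ closure Ω, u i x = c := fun i σ k hσ h =>
    ⟨(k - d 0 * c) / (σ * d i), fun x hx => by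
      rw [eq_div_iff (mul_ne_zero hσ (hd i).ne'), ← h x hx, hc x hx]; ring⟩
  intro i
  fin_cases i
  · exact ⟨c, hc⟩
  · exact hconst 1 1 c1 one_ne_zero hc1
  · exact hconst 2 (-1) c2 (by norm_num) hc2
  · exact hconst 3 1 c3 one_ne_zero hc3
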